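/- Let $n\ge 1$ be an integer. For a map $f:G\to H$ between commutative groups (written additively) and $h\in G$ put $\Delta_hf(x)=f(x+h)-f(x)$. For $m\ge 0$, $f$ is called a polynomial map of functional degree at most $m$ if $\Delta_{h_1}\cdots\Delta_{h_{m+1}}f=0$ for all $h_1,\dots,h_{m+1}\in G$. For a real-valued Schwartz distribution $f\in\mathcal D(\mathbb R^d)'$ and $h\in\mathbb R^d$ put $(\tau_hf)\{\phi\}=f\{\phi(\cdot-h)\}$ for every test function $\phi$, and $\Delta_hf=\tau_hf-f$. (a) Let $f:G\to H$ be a map between commutative groups and let $E\subseteq G$ generate $G$. If $$\Delta_{h_1}\cdots\Delta_{h_n}f=0\qquad\text{for all }h_1,\dots,h_n\in E,\tag{1}$$ then $f$ is a polynomial map of functional degree at most $n-1$. (b) Let $f:G\to H$ be a continuous map between commutative topological groups, with $H$ Hausdorff, and let $E\subseteq G$ generate a dense subgroup of $G$. If (1) holds, then $f$ is a polynomial map of functional degree at most $n-1$. (c) Let $f\in\mathcal D(\mathbb R^d)'$ and let $E\subseteq\mathbb R^d$ generate a dense subgroup of $\mathbb R^d$. If (1) holds, then $f$ is an ordinary polynomial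 of total degree at most $n-1$ in the distributional sense: there is $p\in\mathbb R[x_1,\dots,x_d]$ of total degree at most $n-1$ such that $f\{\phi\}=\int_{\mathbb R^d}p(x)\phi(x)\,dx$ for all test functions $\phi$. -/

import Mathlib

open MeasureTheory TopologicalSpace Distributions CompactConvergenceCLM

/-- The composition `D h₁ (D h₂ (⋯ (D hₙ f)))` of a family of operators `D h` on `X`, indexed by
steps `h`. With `D h` the forward difference operator of step `h` this is `Δ_{h₁} ⋯ Δ_{hₙ} f`. -/
def composeSteps {S X : Type*} (D : S → X → X) {n : ℕ} (h : Fin n → S) (f : X) : X :=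
  (List.ofFn h).foldr D f

/-- The mixed difference `Δ_{h₁} ⋯ Δ_{hₙ} f` of a function, where
`fwdDiff h f x = f (x + h) - f x`. -/
def mixedDiff {S H : Type*} [AddCommMonoid S] [AddCommGroup H] {n : ℕ}
    (h : Fin n → S) (f : S → H) : S → H :=
  composeSteps fwdDiff h f

/-- `f` is a polynomial map of functional degree at most `m`: it solves Fréchet's mixed functional
equation `Δ_{h₁} ⋯ Δ_{hₘ₊₁} f = 0` for all steps. -/
def IsPolynomialMapOfDegreeLE {S H : Type*} [AddCommMonoid S] [AddCommGroup H]
    (f : S → H) (m : ℕ) : Prop :=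
  ∀ h : Fin (m + 1) → S, mixedDiff h f = 0

noncomputable section

/-- Translation of a function supported in the compact set `K`, for a compact set `L` that
contains the translate `K - h`. -/
def translateSupportedIn {E : Type*} [NormedAddCommGroup E] [NormedSpace ℝ E] (h : E)
    (K L : Compacts E) (hKL : ∀ x, x + h ∈ K → x ∈ L) :
    ContDiffMapSupportedIn E ℝ ⊤ K →L[ℝ] ContDiffMapSupportedIn E ℝ ⊤ L :=
  ContDiffMapSupportedIn.mkCLM ℝ (fun φ x ↦ φ (x + h))
    (fun _ _ _ ↦ rfl) (fun _ _ _ ↦ rfl)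
    (fun φ ↦ φ.contDiff.comp (contDiff_id.add contDiff_const))
    (fun φ x hx ↦ φ.zero_on_compl (fun hxK ↦ hx (hKL x hxK)))
    (fun i _ ↦ ⟨{i}, 1, zero_le_one, fun φ x _ ↦ by
      rw [iteratedFDeriv_comp_add_right]
      simpa using
        ContDiffMapSupportedIn.norm_iteratedFDeriv_apply_le_seminorm_top ℝ (f := φ) (x := x + h)⟩)

/-- The translation `τ_h φ (x) = φ (x + h)` of a test function on the whole space, as a continuous
linear operator on the space of test functions. -/
def translateTest {E : Type*} [NormedAddCommGroup E] [NormedSpace ℝ E] (h : E) :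
    TestFunction (⊤ : Opens E) ℝ ⊤ →L[ℝ] TestFunction (⊤ : Opens E) ℝ ⊤ :=
  TestFunction.limitCLM ℝ
    (fun φ ↦ ⟨fun x ↦ φ (x + h), φ.contDiff.comp (contDiff_id.add contDiff_const),
      φ.hasCompactSupport.comp_homeomorph (Homeomorph.addRight h), fun _ _ ↦ trivial⟩)
    (fun K _ ↦ TestFunction.ofSupportedInCLM ℝ (fun _ _ ↦ trivial) ∘L
      translateSupportedIn h K (K.map (fun y ↦ y + -h) (continuous_add_const (-h)))
        (fun x hx ↦ ⟨x + h, hx, by simp⟩))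
    (fun _ _ _ ↦ rfl)

theorem translateTest_apply {E : Type*} [NormedAddCommGroup E] [NormedSpace ℝ E] (h : E)
    (φ : TestFunction (⊤ : Opens E) ℝ ⊤) (x : E) : translateTest h φ x = φ (x + h) := rfl

/-- The translation of a distribution: `(τ_h T) φ = T (τ_{-h} φ)`. -/
def translateDistribution {E : Type*} [NormedAddCommGroup E] [NormedSpace ℝ E] (h : E)
    (T : Distribution (⊤ : Opens E) ℝ ⊤) : Distribution (⊤ : Opens E) ℝ ⊤ :=
  (translateTest (-h)).precompCompactConvergenceCLM ℝ T

theorem translateDistribution_apply {E : Type*} [NormedAddCommGroup E] [NormedSpace ℝ E] (h : E)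
    (T : Distribution (⊤ : Opens E) ℝ ⊤) (φ : TestFunction (⊤ : Opens E) ℝ ⊤) :
    translateDistribution h T φ = T (translateTest (-h) φ) := rfl

/-- The forward difference of a distribution: `Δ_h T = τ_h T - T`. -/
def diffDistribution {E : Type*} [NormedAddCommGroup E] [NormedSpace ℝ E] (h : E)
    (T : Distribution (⊤ : Opens E) ℝ ⊤) : Distribution (⊤ : Opens E) ℝ ⊤ :=
  translateDistribution h T - T

/-- `(Δ_h T) φ = T (Δ_{-h} φ)`. -/
theorem diffDistribution_apply {E : Type*} [NormedAddCommGroup E] [NormedSpace ℝ E] (h : E)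
    (T : Distribution (⊤ : Opens E) ℝ ⊤) (φ : TestFunction (⊤ : Opens E) ℝ ⊤) :
    diffDistribution h T φ = T (translateTest (-h) φ - φ) := by
  rw [map_sub]; rfl

/-- The mixed difference `Δ_{h₁} ⋯ Δ_{hₙ} T` of a distribution. -/
def mixedDiffDistribution {E : Type*} [NormedAddCommGroup E] [NormedSpace ℝ E] {n : ℕ}
    (h : Fin n → E) (T : Distribution (⊤ : Opens E) ℝ ⊤) : Distribution (⊤ : Opens E) ℝ ⊤ :=
  composeSteps diffDistribution h T

/-- The distribution `T` on `ℝ^d` is the distribution of an ordinary real polynomial in `d`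
variables of total degree at most `m`, that is `T φ = ∫ p(x) φ(x) dx` for all test functions. -/
def IsOrdinaryPolynomialOfDegreeLE {d : ℕ}
    (T : Distribution (⊤ : Opens (EuclideanSpace ℝ (Fin d))) ℝ ⊤) (m : ℕ) : Prop :=
  ∃ p : MvPolynomial (Fin d) ℝ, p.totalDegree ≤ m ∧
    ∀ φ : TestFunction (⊤ : Opens (EuclideanSpace ℝ (Fin d))) ℝ ⊤,
      T φ = ∫ x : EuclideanSpace ℝ (Fin d), MvPolynomial.eval (fun i ↦ x i) p * φ x

end

/-! The steps `h` with `Δ_h g = 0` are the periods of `g`. They form a subgroup, which is closed if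
`g` is continuous with Hausdorff target. So a `g` killed by all `Δ_h` with `h ∈ E` is killed by
every `Δ_h`. Since difference operators commute, the steps can be freed from `E` one at a time
(`composeSteps_eq_zero`); this gives (a) and (b).

For (c), fix a test function `φ`. The function `y ↦ (τ_y T) φ` is continuous, and its mixed
differences come from those of `T`, so (b) and Fréchet's theorem make it a polynomial of degree at
most `m = n - 1`. To recover `T`, use the symmetry `∫ ψ(y) (τ_y T)φ dy = T(ψ * φ) = ∫ φ(y) (τ_y T)ψ
dy`. If `φ` is orthogonal to all monomials of degree at most `m`, the right side vanishes for every
`ψ`; letting `ψ` tend to the Dirac mass at `0` gives `T φ = 0`. Hence `T` vanishes on the common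
kernel of finitely many moment functionals, so it is a linear combination of them. -/

/-! ### Commuting differences and period groups: (a) and (b). -/

theorem foldr_comm_apply {S X : Type*} {D : S → X → X}
    (comm : ∀ h k f, D h (D k f) = D k (D h f)) (h : S) (l : List S) (f : X) :
    l.foldr D (D h f) = D h (l.foldr D f) := by
  induction l with
  | nil => rfl
  | cons a l ih => simp only [List.foldr_cons, ih, comm]

/-- Commuting operators `D h` whose `n`-fold products with steps in `E` annihilate `f` have all
`n`-fold products annihilating `f`, provided that being annihilated by the `D h` with `h ∈ E`
forces being annihilated by all `D h`, within a class `A` stable under the operators. -/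
theorem composeSteps_eq_zero {S X : Type*} [Zero X] {D : S → X → X} {E : Set S} {A : Set X}
    (comm : ∀ h k f, D h (D k f) = D k (D h f)) (stable : ∀ h, ∀ f ∈ A, D h f ∈ A)
    (key : ∀ g ∈ A, (∀ h ∈ E, D h g = 0) → ∀ h, D h g = 0) {n : ℕ} {f : X} (hf : f ∈ A)
    (hE : ∀ h : Fin n → S, (∀ i, h i ∈ E) → composeSteps D h f = 0) (h : Fin n → S) :
    composeSteps D h f = 0 := by
  have hlist : ∀ l : List S, l.length = n → (∀ x ∈ l, x ∈ E) → l.foldr D f = 0 := by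
    rintro l rfl hl
    have := hE l.get fun i ↦ hl _ (l.get_mem i)
    rwa [composeSteps, List.ofFn_get] at this
  suffices H : ∀ n : ℕ, ∀ f ∈ A,
      (∀ l : List S, l.length = n → (∀ x ∈ l, x ∈ E) → l.foldr D f = 0) →
      ∀ l : List S, l.length = n → l.foldr D f = 0 from
    H n f hf hlist _ (List.length_ofFn)
  clear h hlist hE hf f n
  intro n
  induction n with
  | zero =>
    intro f _ hE l hl
    exact hE l hl (by simp [List.length_eq_zero_iff.1 hl])
  | succ n ih =>
    intro f hf hE l hl
    obtain ⟨a, l, rfl⟩ := List.exists_cons_of_length_eq_add_one hl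
    have hlen : l.length = n := by simpa using hl
    have mem : ∀ l : List S, l.foldr D f ∈ A := fun l ↦ by
      induction l with
      | nil => exact hf
      | cons b l ihl => exact stable b _ ihl
    -- For `h ∈ E`, commutation moves `D h` innermost, and `D h f` satisfies the induction
    -- hypothesis with one step fewer. `key` then frees the outermost step `a`.
    refine key _ (mem l) (fun h hh ↦ ?_) a
    rw [← foldr_comm_apply comm]
    refine ih _ (stable h f hf) (fun l' hl' hmem ↦ ?_) l hlen
    rw [foldr_comm_apply comm]
    exact hE (h :: l') (by simp [hl']) (by simpa using ⟨hh, hmem⟩)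

theorem fwdDiff_comm {S H : Type*} [AddCommMonoid S] [AddCommGroup H] (h k : S) (f : S → H) :
    fwdDiff h (fwdDiff k f) = fwdDiff k (fwdDiff h f) := by
  ext x
  simp only [fwdDiff, add_right_comm x h k]
  abel

/-- The group of periods of a function. -/
def periodSubgroup {S H : Type*} [AddCommGroup S] (g : S → H) : AddSubgroup S where
  carrier := {h | ∀ x, g (x + h) = g x}
  zero_mem' := by simp
  add_mem' {a b} ha hb x := by rw [← add_assoc, hb, ha]
  neg_mem' {a} ha x := by simpa using (ha (x + -a)).symm

theorem mem_periodSubgroup_iff {S H : Type*} [AddCommGroup S] [AddCommGroup H] {g : S → H}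
    {h : S} : h ∈ periodSubgroup g ↔ fwdDiff h g = 0 := by
  simp only [funext_iff, fwdDiff, Pi.zero_apply, sub_eq_zero]
  rfl

theorem isPolynomialMapOfDegreeLE_of_closure_eq_top {G H : Type*} [AddCommGroup G]
    [AddCommGroup H] {f : G → H} {E : Set G} {m : ℕ} (hE : AddSubgroup.closure E = ⊤)
    (hf : ∀ h : Fin (m + 1) → G, (∀ i, h i ∈ E) → mixedDiff h f = 0) :
    IsPolynomialMapOfDegreeLE f m := by
  refine composeSteps_eq_zero (A := Set.univ) fwdDiff_comm (by simp) (fun g _ hg h ↦ ?_)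
    (Set.mem_univ _) hf
  have hle : AddSubgroup.closure E ≤ periodSubgroup g :=
    (AddSubgroup.closure_le _).2 fun h hh ↦ mem_periodSubgroup_iff.2 (hg h hh)
  exact mem_periodSubgroup_iff.1 (hle (hE ▸ AddSubgroup.mem_top h))

theorem isPolynomialMapOfDegreeLE_of_dense_closure {G H : Type*} [AddCommGroup G]
    [TopologicalSpace G] [IsTopologicalAddGroup G] [AddCommGroup H] [TopologicalSpace H]
    [IsTopologicalAddGroup H] [T2Space H] {f : G → H} {E : Set G} {m : ℕ} (hfc : Continuous f)
    (hE : Dense (AddSubgroup.closure E : Set G))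
    (hf : ∀ h : Fin (m + 1) → G, (∀ i, h i ∈ E) → mixedDiff h f = 0) :
    IsPolynomialMapOfDegreeLE f m := by
  refine composeSteps_eq_zero (A := {f | Continuous f}) fwdDiff_comm
    (fun h f (hf : Continuous f) ↦ (hf.comp (continuous_add_const h)).sub hf)
    (fun g (hgc : Continuous g) hg h ↦ ?_) hfc hf
  have hle : AddSubgroup.closure E ≤ periodSubgroup g :=
    (AddSubgroup.closure_le _).2 fun h hh ↦ mem_periodSubgroup_iff.2 (hg h hh)
  have hclosed : IsClosed (periodSubgroup g : Set G) := by
    have : (periodSubgroup g : Set G) = ⋂ x, {h | g (x + h) = g x} := by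
      ext h; simp [periodSubgroup]
    rw [this]
    exact isClosed_iInter fun x ↦
      isClosed_eq (hgc.comp (continuous_const_add x)) continuous_const
  have := (hE.mono hle).closure_eq
  rw [hclosed.closure_eq] at this
  exact mem_periodSubgroup_iff.1 (this ▸ Set.mem_univ h : h ∈ (periodSubgroup g : Set G))

/-! ### Derivatives of convolutions. -/

open scoped Convolution in
theorem fderiv_convolution_lsmul_apply {E F : Type*} [NormedAddCommGroup E] [NormedSpace ℝ E]
    [MeasurableSpace E] [BorelSpace E] [NormedAddCommGroup F] [NormedSpace ℝ F] {μ : Measure E}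
    [SFinite μ] [μ.IsAddLeftInvariant] {f : E → ℝ} {g : E → F} (hf : LocallyIntegrable f μ)
    (hg : ContDiff ℝ 1 g) (hgc : HasCompactSupport g) (x v : E) :
    fderiv ℝ (f ⋆[ContinuousLinearMap.lsmul ℝ ℝ, μ] g) x v =
      ∫ t, f t • fderiv ℝ g (x - t) v ∂μ := by
  have h : ConvolutionExists f (fderiv ℝ g) ((ContinuousLinearMap.lsmul ℝ ℝ).precompR E) μ :=
    (hgc.fderiv ℝ).convolutionExists_right _ hf (hg.continuous_fderiv one_ne_zero)
  rw [(hgc.hasFDerivAt_convolution_right _ hf hg x).fderiv, convolution_def,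
    ContinuousLinearMap.integral_apply (h x)]
  rfl

-- Evaluating on fixed directions keeps all values in `F`, so the first-order formula can be
-- iterated on `z ↦ iteratedFDeriv ℝ i g z (Fin.tail m)`.
open scoped Convolution in
theorem iteratedFDeriv_convolution_lsmul_apply {E F : Type*} [NormedAddCommGroup E]
    [NormedSpace ℝ E] [MeasurableSpace E] [BorelSpace E] [NormedAddCommGroup F] [NormedSpace ℝ F]
    {μ : Measure E} [SFinite μ] [μ.IsAddLeftInvariant] {f : E → ℝ} {g : E → F}
    (hf : LocallyIntegrable f μ) (hg : ContDiff ℝ (⊤ : ℕ∞) g) (hgc : HasCompactSupport g)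
    (i : ℕ) (x : E) (m : Fin i → E) :
    iteratedFDeriv ℝ i (f ⋆[ContinuousLinearMap.lsmul ℝ ℝ, μ] g) x m =
      ∫ t, f t • iteratedFDeriv ℝ i g (x - t) m ∂μ := by
  induction i generalizing x with
  | zero => rfl
  | succ i ih =>
    have hdiff : ∀ {h : E → F}, ContDiff ℝ (⊤ : ℕ∞) h → ContDiff ℝ 1 (iteratedFDeriv ℝ i h) :=
      fun hh ↦ hh.iteratedFDeriv_right (by exact_mod_cast le_top)
    have hc := hgc.contDiff_convolution_right (ContinuousLinearMap.lsmul ℝ ℝ) hf hg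
    have hgm : ContDiff ℝ 1 fun z ↦ iteratedFDeriv ℝ i g z (Fin.tail m) :=
      (ContinuousMultilinearMap.apply ℝ (fun _ : Fin i ↦ E) F (Fin.tail m)).contDiff.comp (hdiff hg)
    have hgmc : HasCompactSupport fun z ↦ iteratedFDeriv ℝ i g z (Fin.tail m) :=
      (hgc.iteratedFDeriv i).comp_left (g := fun L : E [×i]→L[ℝ] F ↦ L (Fin.tail m)) rfl
    rw [((hdiff hc).differentiable one_ne_zero).differentiableAt.iteratedFDeriv_succ_apply_left']
    refine Eq.trans ?_ ((fderiv_convolution_lsmul_apply hf hgm hgmc x (m 0)).trans ?_)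
    · congr 2
      ext y
      exact ih y (Fin.tail m)
    · refine integral_congr_ae (.of_forall fun t ↦ congrArg (f t • ·) ?_)
      exact (((hdiff hg).differentiable one_ne_zero).differentiableAt
        |>.iteratedFDeriv_succ_apply_left').symm

open scoped Convolution in
/-- The iterated derivatives of a convolution are convolutions with the iterated derivatives. -/
theorem iteratedFDeriv_convolution_lsmul {E F : Type*} [NormedAddCommGroup E]
    [NormedSpace ℝ E] [MeasurableSpace E] [BorelSpace E] [NormedAddCommGroup F] [NormedSpace ℝ F]
    {μ : Measure E} [SFinite μ] [μ.IsAddLeftInvariant] {f : E → ℝ} {g : E → F}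
    (hf : LocallyIntegrable f μ) (hg : ContDiff ℝ (⊤ : ℕ∞) g) (hgc : HasCompactSupport g)
    (i : ℕ) (x : E) :
    iteratedFDeriv ℝ i (f ⋆[ContinuousLinearMap.lsmul ℝ ℝ, μ] g) x =
      ∫ t, f t • iteratedFDeriv ℝ i g (x - t) ∂μ := by
  have hex : ConvolutionExists f (iteratedFDeriv ℝ i g) (ContinuousLinearMap.lsmul ℝ ℝ) μ :=
    (hgc.iteratedFDeriv _).convolutionExists_right _ hf
      (hg.continuous_iteratedFDeriv (by exact_mod_cast le_top))
  have hint : Integrable (fun t ↦ f t • iteratedFDeriv ℝ i g (x - t)) μ := hex x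
  ext m
  rw [ContinuousMultilinearMap.integral_apply hint m,
    iteratedFDeriv_convolution_lsmul_apply hf hg hgc]
  rfl

/-! ### Functionals bounded by finitely many seminorms. -/

/-- A linear functional bounded by finitely many seminorms of the form `v ↦ ‖J i v‖` is a sum of
continuous linear functionals of the `J i v`. -/
theorem LinearMap.exists_eq_sum_of_le_sup_seminorm {V ι : Type*} [AddCommGroup V] [Module ℝ V]
    {B : ι → Type*} [∀ i, NormedAddCommGroup (B i)] [∀ i, NormedSpace ℝ (B i)]
    (J : Π i, V →ₗ[ℝ] B i) (T : V →ₗ[ℝ] ℝ) (s : Finset ι) (C : NNReal)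
    (hT : (normSeminorm ℝ ℝ).comp T ≤ C • s.sup fun i ↦ (normSeminorm ℝ (B i)).comp (J i)) :
    ∃ L : Π i, B i →L[ℝ] ℝ, ∀ v, T v = ∑ i ∈ s, L i (J i v) := by
  classical
  let Js : V →ₗ[ℝ] (Π i : s, B i) := LinearMap.pi fun i ↦ J i
  have hbound : ∀ v, ‖T v‖ ≤ C * ‖Js v‖ := fun v ↦
    (hT v).trans <| mul_le_mul_of_nonneg_left
      (Seminorm.finset_sup_apply_le (norm_nonneg _) fun i hi ↦ norm_le_pi_norm (Js v) ⟨i, hi⟩) C.2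
  -- The bound makes `T` factor through the range of `Js` in a finite product with sup norm;
  -- Hahn–Banach extends it, and restriction to the factors gives the `L i`.
  have hker : Js.ker ≤ T.ker := fun v hv ↦ by
    have h := hbound v
    rw [LinearMap.mem_ker.1 hv, norm_zero, mul_zero] at h
    exact norm_le_zero_iff.1 h
  let f : Js.range →ₗ[ℝ] ℝ := Js.ker.liftQ T hker ∘ₗ Js.quotKerEquivRange.symm.toLinearMap
  have hf : ∀ v, f ⟨Js v, LinearMap.mem_range_self Js v⟩ = T v := fun v ↦ by
    simp only [f, LinearMap.comp_apply, LinearEquiv.coe_coe]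
    rw [LinearMap.quotKerEquivRange_symm_apply_image Js v (LinearMap.mem_range_self Js v)]
    exact Submodule.liftQ_apply _ _ _
  obtain ⟨L, hL, -⟩ := exists_extension_norm_eq Js.range
    (f.mkContinuous C (by rintro ⟨_, v, rfl⟩; rw [hf]; exact hbound v))
  refine ⟨fun i ↦ if h : i ∈ s then
    L.comp (ContinuousLinearMap.single ℝ (fun i : s ↦ B i) ⟨i, h⟩) else 0, fun v ↦ ?_⟩
  have h1 : T v = L (Js v) :=
    ((hL ⟨Js v, LinearMap.mem_range_self Js v⟩).trans (hf v)).symm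
  rw [h1, ← Finset.univ_sum_single (Js v), map_sum, ← Finset.sum_coe_sort s]
  refine Finset.sum_congr rfl fun i _ ↦ ?_
  simp only [dif_pos i.2]
  rfl

/-- The translates of a continuous compactly supported function, weighted by a continuous
function, form a continuous family of bounded continuous functions. -/
theorem continuous_of_apply_eq_smul_sub {E F : Type*} [NormedAddCommGroup E]
    [NormedAddCommGroup F] [NormedSpace ℝ F] {ψ : E → ℝ} (hψ : Continuous ψ) {g : E → F}
    (hg : Continuous g) (hgc : HasCompactSupport g) {j : E → BoundedContinuousFunction E F}
    (hj : ∀ y x, j y x = ψ y • g (x - y)) : Continuous j := by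
  obtain ⟨C, hC⟩ := hg.bounded_above_of_compact_support hgc
  let k : E → BoundedContinuousFunction E F := fun y ↦
    .ofNormedAddCommGroup (fun x ↦ g (x - y)) (by fun_prop) C fun x ↦ hC _
  have hk : Continuous k := by
    rw [Metric.continuous_iff]
    intro y ε hε
    obtain ⟨δ, hδ, H⟩ := Metric.uniformContinuous_iff.1
      (hgc.uniformContinuous_of_continuous hg) (ε / 2) (by positivity)
    refine ⟨δ, hδ, fun z hz ↦ lt_of_le_of_lt ?_ (half_lt_self hε)⟩
    refine (BoundedContinuousFunction.dist_le (by positivity)).2 fun x ↦ ?_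
    exact (H (by rwa [dist_sub_left])).le
  have hjk : j = fun y ↦ ψ y • k y := by
    ext y x
    exact hj y x
  rw [hjk]
  exact hψ.smul hk

/-- A linear functional bounded by finitely many seminorms `v ↦ ‖J i v‖` is continuous along, and
commutes with the integral of, a compactly supported family `w` such that the `J i (w y)` are
weighted translates of continuous compactly supported functions. -/
theorem continuous_and_integral_eq_of_le_sup_seminorm {E V ι : Type*} [NormedAddCommGroup E]
    [MeasurableSpace E] [BorelSpace E] {μ : Measure E} [IsFiniteMeasureOnCompacts μ]
    [AddCommGroup V] [Module ℝ V] {F : ι → Type*} [∀ i, NormedAddCommGroup (F i)]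
    [∀ i, NormedSpace ℝ (F i)] [∀ i, CompleteSpace (F i)]
    {J : Π i, V →ₗ[ℝ] BoundedContinuousFunction E (F i)} {T : V →ₗ[ℝ] ℝ} {s : Finset ι}
    {C : NNReal}
    (hT : (normSeminorm ℝ ℝ).comp T ≤
      C • s.sup fun i ↦ (normSeminorm ℝ (BoundedContinuousFunction E (F i))).comp (J i))
    {ψ : E → ℝ} (hψ : Continuous ψ) (hψc : HasCompactSupport ψ) {g : Π i, E → F i}
    (hg : ∀ i, Continuous (g i)) (hgc : ∀ i, HasCompactSupport (g i)) {w : E → V}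
    (hw : ∀ i y x, J i (w y) x = ψ y • g i (x - y)) {c : V}
    (hc : ∀ i x, J i c x = ∫ y, ψ y • g i (x - y) ∂μ) :
    (Continuous fun y ↦ T (w y)) ∧ T c = ∫ y, T (w y) ∂μ := by
  -- `V` has no topology; the integrals are Bochner integrals in the Banach spaces of bounded
  -- continuous functions, where each `L i` commutes with them.
  obtain ⟨L, hL⟩ := T.exists_eq_sum_of_le_sup_seminorm J s C hT
  have hcont : ∀ i, Continuous fun y ↦ J i (w y) := fun i ↦
    continuous_of_apply_eq_smul_sub hψ (hg i) (hgc i) (hw i)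
  have hint : ∀ i, Integrable (fun y ↦ J i (w y)) μ := fun i ↦
    (hcont i).integrable_of_hasCompactSupport <| hψc.mono fun y hy hψy ↦ hy <| by
      ext x
      rw [hw, hψy, zero_smul]
      rfl
  have hJc : ∀ i, J i c = ∫ y, J i (w y) ∂μ := fun i ↦ by
    ext x
    refine (hc i x).trans ?_
    refine Eq.trans ?_ ((BoundedContinuousFunction.evalCLM ℝ x).integral_comp_comm (hint i))
    exact integral_congr_ae (.of_forall fun y ↦ (hw i y x).symm)
  simp only [hL]
  refine ⟨continuous_finsetSum _ fun i _ ↦ (L i).continuous.comp (hcont i), ?_⟩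
  rw [integral_finsetSum _ fun i _ ↦ (L i).integrable_comp (hint i)]
  refine Finset.sum_congr rfl fun i _ ↦ ?_
  rw [(L i).integral_comp_comm (hint i), hJc]

/-! ### Distributions paired with translates and convolutions. -/

noncomputable section

open scoped Convolution in
/-- The convolution of two test functions. -/
def TestFunction.conv {E : Type*} [NormedAddCommGroup E] [NormedSpace ℝ E]
    [FiniteDimensional ℝ E] [MeasurableSpace E] [BorelSpace E] (μ : Measure E)
    [μ.IsAddHaarMeasure] (ψ φ : TestFunction (⊤ : Opens E) ℝ ⊤) :
    TestFunction (⊤ : Opens E) ℝ ⊤ where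
  toFun := ψ ⋆[ContinuousLinearMap.lsmul ℝ ℝ, μ] φ
  contDiff' := φ.hasCompactSupport.contDiff_convolution_right _
    ψ.continuous.locallyIntegrable φ.contDiff
  hasCompactSupport' := ψ.hasCompactSupport.convolution _ φ.hasCompactSupport
  tsupport_subset' _ _ := trivial

theorem TestFunction.conv_comm {E : Type*} [NormedAddCommGroup E] [NormedSpace ℝ E]
    [FiniteDimensional ℝ E] [MeasurableSpace E] [BorelSpace E] (μ : Measure E)
    [μ.IsAddHaarMeasure] (ψ φ : TestFunction (⊤ : Opens E) ℝ ⊤) : ψ.conv μ φ = φ.conv μ ψ := by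
  ext x
  change convolution _ _ _ _ _ = convolution _ _ _ _ _
  rw [convolution_eq_swap, convolution_def]
  simp [mul_comm]

/-- Pairing a distribution with the translates of a test function gives, after multiplication by
another test function, a continuous function whose integral is the pairing with the
convolution. -/
theorem continuous_and_integral_mul_translateDistribution {E : Type*} [NormedAddCommGroup E]
    [NormedSpace ℝ E] [FiniteDimensional ℝ E] [MeasurableSpace E] [BorelSpace E] (μ : Measure E)
    [μ.IsAddHaarMeasure] (T : Distribution (⊤ : Opens E) ℝ ⊤)
    (ψ φ : TestFunction (⊤ : Opens E) ℝ ⊤) :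
    (Continuous fun y ↦ ψ y * translateDistribution y T φ) ∧
      T (ψ.conv μ φ) = ∫ y, ψ y * translateDistribution y T φ ∂μ := by
  -- This sumset supports every `ψ y • φ (· - y)` as well as `ψ * φ`, so a single seminorm bound
  -- serves for all of them.
  let K : Compacts E := ⟨(fun p : E × E ↦ p.1 + p.2) '' (tsupport ψ ×ˢ tsupport φ),
    (ψ.hasCompactSupport.prod φ.hasCompactSupport).image continuous_add⟩
  let I : ContDiffMapSupportedIn E ℝ ⊤ K →L[ℝ] TestFunction (⊤ : Opens E) ℝ ⊤ :=
    TestFunction.ofSupportedInCLM ℝ (fun _ _ ↦ trivial)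
  let TK : ContDiffMapSupportedIn E ℝ ⊤ K →ₗ[ℝ] ℝ :=
    { toFun := fun φ ↦ T (I φ)
      map_add' := fun φ ψ ↦ by rw [map_add, map_add]
      map_smul' := fun c φ ↦ by rw [map_smul, map_smul]; rfl }
  have hTK : Continuous TK :=
    (show Continuous T from ContinuousLinearMap.continuous _).comp I.continuous
  obtain ⟨s, C, -, hC⟩ := Seminorm.bound_of_continuous
    (ContDiffMapSupportedIn.withSeminorms ℝ E ℝ ⊤ K) ((normSeminorm ℝ ℝ).comp TK) hTK.norm
  let w : E → ContDiffMapSupportedIn E ℝ ⊤ K := fun y ↦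
    .of_support_subset (f := fun x ↦ ψ y • φ (x - y))
      ((φ.contDiff.comp (contDiff_id.sub contDiff_const)).const_smul _) (by
        intro x hx
        refine ⟨(y, x - y), ⟨subset_closure fun h ↦ hx ?_, subset_closure fun h ↦ hx ?_⟩, by simp⟩
        · simp [h]
        · simp [h])
  let c : ContDiffMapSupportedIn E ℝ ⊤ K :=
    .of_support_subset (ψ.conv μ φ).contDiff (by
      refine (support_convolution_subset _).trans ?_
      rintro _ ⟨a, ha, b, hb, rfl⟩
      exact ⟨(a, b), ⟨subset_closure ha, subset_closure hb⟩, rfl⟩)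
  have hTw : ∀ y, TK (w y) = ψ y * translateDistribution y T φ := by
    intro y
    have hIw : I (w y) = ψ y • translateTest (-y) φ := by
      ext x
      change ψ y • φ (x - y) = ψ y • φ (x + -y)
      rw [sub_eq_add_neg]
    change T (I (w y)) = _
    rw [hIw, map_smul, translateDistribution_apply, smul_eq_mul]
  have hJw : ∀ (i : ℕ) (y x : E),
      iteratedFDeriv ℝ i (w y) x = ψ y • iteratedFDeriv ℝ i φ (x - y) := by
    intro i y x
    have hsm : ContDiff ℝ i fun x ↦ φ (x - y) :=
      (φ.contDiff.comp (contDiff_id.sub contDiff_const)).of_le (by exact_mod_cast le_top)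
    rw [← iteratedFDeriv_comp_sub]
    exact iteratedFDeriv_const_smul_apply (a := ψ y) hsm.contDiffAt
  have hJc : ∀ (i : ℕ) (x : E),
      iteratedFDeriv ℝ i c x = ∫ y, ψ y • iteratedFDeriv ℝ i φ (x - y) ∂μ :=
    iteratedFDeriv_convolution_lsmul ψ.continuous.locallyIntegrable φ.contDiff
      φ.hasCompactSupport
  have main := continuous_and_integral_eq_of_le_sup_seminorm (μ := μ)
    (F := fun i : ℕ ↦ E [×i]→L[ℝ] ℝ)
    (J := fun i ↦ ContDiffMapSupportedIn.structureMapLM ℝ ⊤ i) hC ψ.continuous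
    ψ.hasCompactSupport (g := fun i ↦ iteratedFDeriv ℝ i φ)
    (fun i ↦ φ.contDiff.continuous_iteratedFDeriv (by exact_mod_cast le_top))
    (fun i ↦ φ.hasCompactSupport.iteratedFDeriv i) (w := w) (c := c)
    (fun i y x ↦ by
      rw [← hJw]
      exact congrFun (ContDiffMapSupportedIn.structureMapLM_top_apply ℝ (w y)) x)
    (fun i x ↦ by
      rw [← hJc]
      exact congrFun (ContDiffMapSupportedIn.structureMapLM_top_apply ℝ c) x)
  simp only [hTw] at main
  exact main

theorem continuous_translateDistribution_apply {E : Type*} [NormedAddCommGroup E]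
    [NormedSpace ℝ E] [FiniteDimensional ℝ E] (T : Distribution (⊤ : Opens E) ℝ ⊤)
    (φ : TestFunction (⊤ : Opens E) ℝ ⊤) : Continuous fun y ↦ translateDistribution y T φ := by
  borelize E
  refine continuous_iff_continuousAt.2 fun y₀ ↦ ?_
  -- A weight equal to `1` near `y₀` does not affect continuity there.
  let b : ContDiffBump y₀ := ⟨1, 2, one_pos, one_lt_two⟩
  let ψ : TestFunction (⊤ : Opens E) ℝ ⊤ :=
    ⟨b, b.contDiff, b.hasCompactSupport, fun _ _ ↦ trivial⟩
  refine (continuous_and_integral_mul_translateDistribution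
    (Measure.addHaar : Measure E) T ψ φ).1.continuousAt.congr ?_
  filter_upwards [b.eventuallyEq_one] with y hy
  change b y * _ = _
  rw [hy, Pi.one_apply, one_mul]

/-- The functions `y ↦ τ_y T φ` obtained from a distribution are symmetric kernels. -/
theorem integral_mul_translateDistribution_comm {E : Type*} [NormedAddCommGroup E]
    [NormedSpace ℝ E] [FiniteDimensional ℝ E] [MeasurableSpace E] [BorelSpace E] (μ : Measure E)
    [μ.IsAddHaarMeasure] (T : Distribution (⊤ : Opens E) ℝ ⊤)
    (ψ φ : TestFunction (⊤ : Opens E) ℝ ⊤) :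
    ∫ y, ψ y * translateDistribution y T φ ∂μ = ∫ y, φ y * translateDistribution y T ψ ∂μ := by
  rw [← (continuous_and_integral_mul_translateDistribution μ T ψ φ).2,
    ← (continuous_and_integral_mul_translateDistribution μ T φ ψ).2, ψ.conv_comm μ φ]

end

/-! ### Fréchet's theorem for continuous functions on `ℝ^d`. -/

theorem composeSteps_const {S X : Type*} (D : S → X → X) (n : ℕ) (h : S) (f : X) :
    composeSteps D (fun _ : Fin n ↦ h) f = (D h)^[n] f := by
  rw [composeSteps, List.ofFn_const]
  induction n with
  | zero => rfl
  | succ n ih => rw [List.replicate_succ, List.foldr_cons, ih, Function.iterate_succ_apply']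

/-- Along an arithmetic progression, a function with vanishing `(m + 1)`-st difference agrees with
a polynomial of degree at most `m` in the index. -/
theorem exists_polynomial_eval_natCast {M : Type*} [AddCommMonoid M] {m : ℕ} {h : M} {f : M → ℝ}
    (hf : (fwdDiff h)^[m + 1] f = 0) (y : M) :
    ∃ P : Polynomial ℝ, P.natDegree ≤ m ∧ ∀ k : ℕ, f (y + k • h) = P.eval (k : ℝ) := by
  -- Newton's forward difference formula, with `k.choose j` written as a polynomial in `k`.
  refine ⟨∑ j ∈ Finset.range (m + 1),
    Polynomial.C ((fwdDiff h)^[j] f y / j.factorial) * descPochhammer ℝ j, ?_, fun k ↦ ?_⟩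
  · refine Polynomial.natDegree_sum_le_of_forall_le _ _ fun j hj ↦ ?_
    refine (Polynomial.natDegree_C_mul_le _ _).trans ?_
    rw [descPochhammer_natDegree]
    exact Nat.lt_succ_iff.1 (Finset.mem_range.1 hj)
  · have hzero : ∀ j, m + 1 ≤ j → (fwdDiff h)^[j] f = 0 := by
      intro j hj
      obtain ⟨i, rfl⟩ := Nat.exists_eq_add_of_le hj
      rw [add_comm, Function.iterate_add_apply, hf]
      exact Function.iterate_fixed (by ext; simp [fwdDiff]) i
    have hterm : ∀ j, (Polynomial.C ((fwdDiff h)^[j] f y / j.factorial) *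
        descPochhammer ℝ j).eval (k : ℝ) = k.choose j • (fwdDiff h)^[j] f y := by
      intro j
      rw [Polynomial.eval_mul, Polynomial.eval_C, nsmul_eq_mul,
        Nat.cast_choose_eq_descPochhammer_div]
      ring
    rw [shift_eq_sum_fwdDiff_iter h f k y, Polynomial.eval_finsetSum, Finset.sum_congr rfl fun j _ ↦ hterm j]
    rcases le_total (k + 1) (m + 1) with hle | hle
    · refine Finset.sum_subset (Finset.range_mono hle) fun j _ hj ↦ ?_
      rw [Nat.choose_eq_zero_of_lt (by simpa using hj), zero_smul]
    · refine (Finset.sum_subset (Finset.range_mono hle) fun j _ hj ↦ ?_).symm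
      rw [hzero j (by simpa using hj), Pi.zero_apply, smul_zero]

theorem Polynomial.degree_lt_card_range {m : ℕ} {p : Polynomial ℝ} (hp : p.natDegree ≤ m) :
    p.degree < (Finset.range (m + 1)).card := by
  rw [Finset.card_range]
  exact (Polynomial.degree_le_of_natDegree_le hp).trans_lt (by exact_mod_cast m.lt_succ_self)

/-- Interpolate `g` at `0, …, m`. A progression of step `1 / q.den` passes through these integers
and through `q`; `g` is polynomial of degree at most `m` along it, so it agrees there with the
interpolant. Continuity extends this from `ℚ` to `ℝ`. -/
theorem exists_polynomial_of_iterate_fwdDiff_eq_zero {m : ℕ} {g : ℝ → ℝ} (hg : Continuous g)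
    (hd : ∀ h, (fwdDiff h)^[m + 1] g = 0) :
    ∃ p : Polynomial ℝ, p.natDegree ≤ m ∧ ∀ t, g t = p.eval t := by
  have hinj : Set.InjOn (fun i : ℕ ↦ (i : ℝ)) (Finset.range (m + 1)) :=
    Nat.cast_injective.injOn
  set p := Lagrange.interpolate (Finset.range (m + 1)) (fun i : ℕ ↦ (i : ℝ)) (fun i ↦ g i) with hp
  have hdeg : p.natDegree ≤ m := by
    refine Polynomial.natDegree_le_of_degree_le ((Lagrange.degree_interpolate_le _ hinj).trans ?_)
    simp
  refine ⟨p, hdeg, ?_⟩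
  suffices H : ∀ q : ℚ, g q = p.eval (q : ℝ) from
    congrFun (Rat.denseRange_cast.equalizer hg p.continuous (funext H))
  intro q
  -- Starting the progression at `-M` gives `q` a natural index.
  obtain ⟨M, hM⟩ : ∃ M : ℕ, 0 ≤ q.num + M * q.den := by
    refine ⟨q.num.natAbs, ?_⟩
    have h1 : (1 : ℤ) ≤ q.den := by exact_mod_cast q.pos
    have h2 : -q.num ≤ q.num.natAbs := by omega
    nlinarith [Int.natCast_nonneg q.num.natAbs]
  have hden : (q.den : ℝ) ≠ 0 := by exact_mod_cast q.den_nz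
  obtain ⟨P, hP, hPk⟩ := exists_polynomial_eval_natCast (hd (q.den : ℝ)⁻¹) (-(M : ℝ))
  set A : Polynomial ℝ := Polynomial.C (q.den : ℝ)⁻¹ * Polynomial.X + Polynomial.C (-(M : ℝ))
  have hA : ∀ x : ℝ, A.eval x = -(M : ℝ) + x * (q.den : ℝ)⁻¹ := fun x ↦ by
    simp [A]; ring
  have hAdeg : (p.comp A).natDegree ≤ m := by
    rw [Polynomial.natDegree_comp]
    calc p.natDegree * A.natDegree ≤ m * 1 :=
          Nat.mul_le_mul hdeg (Polynomial.natDegree_linear_le)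
      _ = m := mul_one m
  have key : P = p.comp A := by
    -- The progression meets the integer `i` at index `(M + i) * q.den`.
    refine Polynomial.eq_of_degrees_lt_of_eval_index_eq (Finset.range (m + 1))
      (v := fun i : ℕ ↦ (((M + i) * q.den : ℕ) : ℝ)) (fun i _ j _ hij ↦ ?_)
      (Polynomial.degree_lt_card_range hP) (Polynomial.degree_lt_card_range hAdeg) fun i hi ↦ ?_
    · have := Nat.eq_of_mul_eq_mul_right q.pos (Nat.cast_injective hij)
      omega
    · have hx : -(M : ℝ) + (((M + i) * q.den : ℕ) : ℝ) * (q.den : ℝ)⁻¹ = i := by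
        push_cast
        field_simp
        ring
      rw [← hPk, Polynomial.eval_comp, hA, nsmul_eq_mul, hx]
      exact (Lagrange.eval_interpolate_at_node (fun i : ℕ ↦ g i) hinj hi).symm
  have hk : (((q.num + M * q.den).toNat : ℕ) : ℝ) = q.num + M * q.den := by
    exact_mod_cast congrArg (Int.cast : ℤ → ℝ) (Int.toNat_of_nonneg hM)
  have hq : -(M : ℝ) + (((q.num + M * q.den).toNat : ℕ) : ℝ) * (q.den : ℝ)⁻¹ = q := by
    rw [hk, Rat.cast_def]
    field_simp
    ring
  have := hPk (q.num + M * q.den).toNat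
  rwa [key, Polynomial.eval_comp, hA, nsmul_eq_mul, hq] at this

/-- A function of finitely many variables that is polynomial of bounded degree in each variable
separately is polynomial. -/
theorem exists_mvPolynomial_of_forall_update {ι : Type*} [Fintype ι] [DecidableEq ι] {m : ℕ}
    {f : (ι → ℝ) → ℝ}
    (hf : ∀ x i, ∃ p : Polynomial ℝ, p.natDegree ≤ m ∧
      ∀ t, f (Function.update x i t) = p.eval t) :
    ∃ P : MvPolynomial ι ℝ, ∀ x, f x = MvPolynomial.eval x P := by
  suffices H : ∀ (s : Finset ι) (z : ι → ℝ),
      ∃ P : MvPolynomial ι ℝ, ∀ x, f (s.piecewise x z) = MvPolynomial.eval x P by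
    obtain ⟨P, hP⟩ := H Finset.univ 0
    exact ⟨P, fun x ↦ by rw [← hP, Finset.piecewise_univ]⟩
  intro s
  induction s using Finset.induction_on with
  | empty => exact fun z ↦ ⟨MvPolynomial.C (f z), by simp⟩
  | insert i s hi ih =>
    intro z
    -- `Q j` represents `f` with coordinate `i` frozen at the node `j`; Lagrange interpolation in
    -- that coordinate glues the `Q j`.
    choose Q hQ using fun j : ℕ ↦ ih (Function.update z i j)
    let b : ℕ → Polynomial ℝ := Lagrange.basis (Finset.range (m + 1)) fun i : ℕ ↦ (i : ℝ)
    refine ⟨∑ j ∈ Finset.range (m + 1), Polynomial.aeval (MvPolynomial.X i) (b j) * Q j,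
      fun x ↦ ?_⟩
    obtain ⟨p, hp, hpt⟩ := hf (s.piecewise x z) i
    have hlag := Lagrange.eq_interpolate (f := p) (s := Finset.range (m + 1))
      (v := fun i : ℕ ↦ (i : ℝ)) Nat.cast_injective.injOn (Polynomial.degree_lt_card_range hp)
    rw [Finset.piecewise_insert, hpt, hlag, Lagrange.interpolate_apply, Polynomial.eval_finsetSum,
      map_sum]
    refine Finset.sum_congr rfl fun j _ ↦ ?_
    rw [Polynomial.eval_mul, Polynomial.eval_C, ← hpt, s.update_piecewise_of_notMem _ _ hi,
      hQ, map_mul, mul_comm]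
    congr 1
    rw [← MvPolynomial.coe_aeval_eq_eval, RingHom.coe_coe, ← Polynomial.aeval_algHom_apply,
      MvPolynomial.aeval_X]
    rfl

theorem MvPolynomial.eval_smul_homogeneousComponent {ι R : Type*} [CommSemiring R] (k : ℕ)
    (P : MvPolynomial ι R) (t : R) (v : ι → R) :
    eval (t • v) (homogeneousComponent k P) = t ^ k * eval v (homogeneousComponent k P) := by
  simp only [homogeneousComponent_apply, map_sum, Finset.mul_sum, eval_monomial]
  refine Finset.sum_congr rfl fun s hs ↦ ?_
  rw [← (Finset.mem_filter.1 hs).2, Finsupp.degree_apply]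
  simp only [Finsupp.prod, Pi.smul_apply, smul_eq_mul, mul_pow, Finset.prod_mul_distrib,
    Finset.prod_pow_eq_pow_sum]
  ring

/-- The coefficient of `t ^ k` in `P (t • v)` is the degree-`k` homogeneous component at `v`. For `k
> m` it vanishes for all `v`, so the component is zero. -/
theorem totalDegree_le_of_forall_line {ι : Type*} {m : ℕ} {P : MvPolynomial ι ℝ}
    (hP : ∀ v : ι → ℝ, ∃ p : Polynomial ℝ, p.natDegree ≤ m ∧
      ∀ t : ℝ, MvPolynomial.eval (t • v) P = p.eval t) :
    P.totalDegree ≤ m := by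
  have hcomp : ∀ k, m < k → MvPolynomial.homogeneousComponent k P = 0 := by
    intro k hk
    by_cases hkP : P.totalDegree < k
    · exact MvPolynomial.homogeneousComponent_eq_zero _ _ hkP
    refine MvPolynomial.funext fun v ↦ ?_
    obtain ⟨p, hp, hpt⟩ := hP v
    have hpeq : p = ∑ j ∈ Finset.range (P.totalDegree + 1),
        Polynomial.C (MvPolynomial.eval v (MvPolynomial.homogeneousComponent j P)) *
          Polynomial.X ^ j := by
      refine Polynomial.funext fun t ↦ ?_
      rw [← hpt, Polynomial.eval_finsetSum]
      nth_rewrite 1 [← MvPolynomial.sum_homogeneousComponent P]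
      rw [map_sum]
      refine Finset.sum_congr rfl fun j _ ↦ ?_
      rw [Polynomial.eval_mul, Polynomial.eval_C, Polynomial.eval_pow, Polynomial.eval_X]
      rw [MvPolynomial.eval_smul_homogeneousComponent, mul_comm]
    have hc : p.coeff k = 0 := Polynomial.coeff_eq_zero_of_natDegree_lt (hp.trans_lt hk)
    rw [hpeq, Polynomial.finsetSum_coeff] at hc
    simpa [Polynomial.coeff_C_mul, Polynomial.coeff_X_pow, Nat.lt_succ_iff, hkP,
      not_lt.1 hkP] using hc
  refine Finset.sup_le fun s hs ↦ ?_
  change s.degree ≤ m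
  by_contra hlt
  have := congrArg (MvPolynomial.coeff s) (hcomp _ (not_le.1 hlt))
  rw [MvPolynomial.coeff_homogeneousComponent] at this
  simp_all

/-- Fréchet's theorem: a continuous real function on `ℝ^d` all of whose `(m + 1)`-fold mixed
differences vanish is a polynomial of total degree at most `m`. -/
theorem IsPolynomialMapOfDegreeLE.exists_mvPolynomial {d m : ℕ}
    {f : EuclideanSpace ℝ (Fin d) → ℝ} (hf : IsPolynomialMapOfDegreeLE f m) (hc : Continuous f) :
    ∃ P : MvPolynomial (Fin d) ℝ, P.totalDegree ≤ m ∧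
      ∀ x, f x = MvPolynomial.eval (fun i ↦ x i) P := by
  have hline : ∀ a v : EuclideanSpace ℝ (Fin d), ∃ p : Polynomial ℝ, p.natDegree ≤ m ∧
      ∀ t : ℝ, f (a + t • v) = p.eval t := by
    intro a v
    refine exists_polynomial_of_iterate_fwdDiff_eq_zero (by fun_prop) fun h ↦ ?_
    have hiter : ∀ n, (fwdDiff h)^[n] (fun t : ℝ ↦ f (a + t • v)) =
        fun t ↦ (fwdDiff (h • v))^[n] f (a + t • v) := by
      intro n
      induction n with
      | zero => rfl
      | succ n ih =>
        ext t
        rw [Function.iterate_succ_apply', Function.iterate_succ_apply', ih]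
        simp only [fwdDiff, add_smul, add_assoc]
    have hz := hf fun _ ↦ h • v
    rw [mixedDiff, composeSteps_const] at hz
    rw [hiter, hz]
    rfl
  -- Lines parallel to the axes give polynomiality; lines through `0` then bound the total degree.
  obtain ⟨P, hP⟩ := exists_mvPolynomial_of_forall_update (m := m)
    (f := fun x ↦ f (WithLp.toLp 2 x)) fun x i ↦ by
      obtain ⟨p, hp, hpt⟩ := hline (WithLp.toLp 2 (Function.update x i 0))
        (EuclideanSpace.single i 1)
      refine ⟨p, hp, fun t ↦ ?_⟩
      rw [← hpt]
      congr 1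
      ext j
      by_cases hj : j = i
      · subst hj; simp
      · simp [hj]
  refine ⟨P, totalDegree_le_of_forall_line fun v ↦ ?_, fun x ↦ hP x.ofLp⟩
  obtain ⟨p, hp, hpt⟩ := hline 0 (WithLp.toLp 2 v)
  refine ⟨p, hp, fun t ↦ ?_⟩
  rw [← hpt, ← hP, zero_add]
  rfl

/-! ### From polynomial pairings to a polynomial distribution: (c). -/

theorem translateDistribution_diffDistribution_apply {E : Type*} [NormedAddCommGroup E]
    [NormedSpace ℝ E] (h : E) (T : Distribution (⊤ : Opens E) ℝ ⊤)
    (φ : TestFunction (⊤ : Opens E) ℝ ⊤) :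
    (fun y ↦ translateDistribution y (diffDistribution h T) φ) =
      fwdDiff h fun y ↦ translateDistribution y T φ := by
  ext y
  simp only [fwdDiff, translateDistribution_apply, diffDistribution_apply, map_sub]
  congr 2
  ext x
  simp only [translateTest_apply, neg_add_rev, add_assoc]

theorem translateDistribution_mixedDiffDistribution_apply {E : Type*} [NormedAddCommGroup E]
    [NormedSpace ℝ E] {n : ℕ} (h : Fin n → E) (T : Distribution (⊤ : Opens E) ℝ ⊤)
    (φ : TestFunction (⊤ : Opens E) ℝ ⊤) :
    (fun y ↦ translateDistribution y (mixedDiffDistribution h T) φ) =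
      mixedDiff h fun y ↦ translateDistribution y T φ := by
  simp only [mixedDiffDistribution, mixedDiff, composeSteps]
  induction List.ofFn h with
  | nil => rfl
  | cons a l ih =>
    rw [List.foldr_cons, List.foldr_cons, translateDistribution_diffDistribution_apply, ih]

theorem isPolynomialMapOfDegreeLE_translateDistribution {E : Type*} [NormedAddCommGroup E]
    [NormedSpace ℝ E] [FiniteDimensional ℝ E] {T : Distribution (⊤ : Opens E) ℝ ⊤} {S : Set E}
    {m : ℕ} (hS : Dense (AddSubgroup.closure S : Set E))
    (hT : ∀ h : Fin (m + 1) → E, (∀ i, h i ∈ S) → mixedDiffDistribution h T = 0)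
    (φ : TestFunction (⊤ : Opens E) ℝ ⊤) :
    IsPolynomialMapOfDegreeLE (fun y ↦ translateDistribution y T φ) m := by
  refine isPolynomialMapOfDegreeLE_of_dense_closure
    (continuous_translateDistribution_apply T φ) hS fun h hh ↦ ?_
  rw [← translateDistribution_mixedDiffDistribution_apply, hT h hh]
  rfl

/-- A distribution is determined at `φ` by its pairings with the convolutions of `φ` with bump
functions. -/
theorem apply_eq_zero_of_forall_integral_eq_zero {E : Type*} [NormedAddCommGroup E]
    [InnerProductSpace ℝ E] [FiniteDimensional ℝ E] [MeasurableSpace E] [BorelSpace E]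
    (μ : Measure E) [μ.IsAddHaarMeasure] (T : Distribution (⊤ : Opens E) ℝ ⊤)
    (φ : TestFunction (⊤ : Opens E) ℝ ⊤)
    (h : ∀ ψ : TestFunction (⊤ : Opens E) ℝ ⊤, ∫ y, ψ y * translateDistribution y T φ ∂μ = 0) :
    T φ = 0 := by
  let b : ℕ → ContDiffBump (0 : E) := fun k ↦
    ⟨1 / (k + 1) / 2, 1 / (k + 1), half_pos Nat.one_div_pos_of_nat,
      half_lt_self Nat.one_div_pos_of_nat⟩
  -- The reflection cancels the sign in the convolution at `0`, which becomes the integral in `h`;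
  -- its limit is `(τ_0 T) φ = T φ`.
  have hG : Continuous fun y ↦ translateDistribution (-y) T φ :=
    (continuous_translateDistribution_apply T φ).comp continuous_neg
  have hlim := ContDiffBump.convolution_tendsto_right_of_continuous (μ := μ) (φ := b)
    tendsto_one_div_add_atTop_nhds_zero_nat hG 0
  have hconst : ∀ k, convolution ((b k).normed μ) (fun y ↦ translateDistribution (-y) T φ)
      (ContinuousLinearMap.lsmul ℝ ℝ) μ 0 = 0 := by
    intro k
    let ψ : TestFunction (⊤ : Opens E) ℝ ⊤ :=
      ⟨(b k).normed μ, (b k).contDiff_normed, (b k).hasCompactSupport_normed, fun _ _ ↦ trivial⟩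
    refine Eq.trans (integral_congr_ae (.of_forall fun y ↦ ?_)) (h ψ)
    simp only [zero_sub, neg_neg]
    rfl
  simp only [hconst] at hlim
  have h0 := tendsto_nhds_unique hlim tendsto_const_nhds
  rw [translateDistribution_apply, neg_zero, neg_zero] at h0
  rw [← h0]
  congr 1
  ext x
  rw [translateTest_apply, add_zero]

theorem continuous_mvPolynomial_eval_ofLp {ι : Type*} [Fintype ι] (p : MvPolynomial ι ℝ) :
    Continuous fun x : EuclideanSpace ℝ ι ↦ MvPolynomial.eval (fun i ↦ x i) p :=
  p.continuous_eval.comp (PiLp.continuous_ofLp 2 _)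

noncomputable section

/-- The pairing of test functions with a polynomial. -/
def polynomialPairing {ι : Type*} [Fintype ι] (p : MvPolynomial ι ℝ) :
    TestFunction (⊤ : Opens (EuclideanSpace ℝ ι)) ℝ ⊤ →ₗ[ℝ] ℝ :=
  (TestFunction.integralAgainstBilinCLM (ContinuousLinearMap.mul ℝ ℝ) volume
    fun x : EuclideanSpace ℝ ι ↦ MvPolynomial.eval (fun i ↦ x i) p).toLinearMap

theorem polynomialPairing_apply {ι : Type*} [Fintype ι] (p : MvPolynomial ι ℝ)
    (φ : TestFunction (⊤ : Opens (EuclideanSpace ℝ ι)) ℝ ⊤) :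
    polynomialPairing p φ =
      ∫ x : EuclideanSpace ℝ ι, φ x * MvPolynomial.eval (fun i ↦ x i) p :=
  TestFunction.integralAgainstBilinCLM_eq_integral
    ((continuous_mvPolynomial_eval_ofLp p).locallyIntegrable.locallyIntegrableOn _)

theorem polynomialPairing_sum_monomial {ι κ : Type*} [Fintype ι] (s : Finset κ)
    (a : κ → ι →₀ ℕ) (c : κ → ℝ) (φ : TestFunction (⊤ : Opens (EuclideanSpace ℝ ι)) ℝ ⊤) :
    polynomialPairing (∑ k ∈ s, MvPolynomial.monomial (a k) (c k)) φ =
      ∑ k ∈ s, c k * polynomialPairing (MvPolynomial.monomial (a k) 1) φ := by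
  have hint : ∀ k, Integrable fun x : EuclideanSpace ℝ ι ↦
      φ x * MvPolynomial.eval (fun i ↦ x i) (MvPolynomial.monomial (a k) (1 : ℝ)) := fun k ↦
    (φ.continuous.mul (continuous_mvPolynomial_eval_ofLp _)).integrable_of_hasCompactSupport
      φ.hasCompactSupport.mul_right
  simp only [polynomialPairing_apply, ← integral_const_mul]
  rw [← integral_finsetSum _ fun k _ ↦ (hint k).const_mul (c k)]
  refine integral_congr_ae (.of_forall fun x ↦ ?_)
  simp only [map_sum, Finset.mul_sum, MvPolynomial.eval_monomial, one_mul]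
  exact Finset.sum_congr rfl fun k _ ↦ by ring

end

theorem isOrdinaryPolynomialOfDegreeLE_of_dense_closure {d m : ℕ}
    {T : Distribution (⊤ : Opens (EuclideanSpace ℝ (Fin d))) ℝ ⊤}
    {S : Set (EuclideanSpace ℝ (Fin d))}
    (hS : Dense (AddSubgroup.closure S : Set (EuclideanSpace ℝ (Fin d))))
    (hT : ∀ h : Fin (m + 1) → EuclideanSpace ℝ (Fin d), (∀ i, h i ∈ S) →
      mixedDiffDistribution h T = 0) :
    IsOrdinaryPolynomialOfDegreeLE T m := by
  let κ := {a : Fin d →₀ ℕ // a.degree ≤ m}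
  have : Finite κ := Set.finite_coe_iff.2 (Finsupp.finite_of_degree_le m)
  have : Fintype κ := Fintype.ofFinite κ
  let M : κ → TestFunction (⊤ : Opens (EuclideanSpace ℝ (Fin d))) ℝ ⊤ →ₗ[ℝ] ℝ :=
    fun a ↦ polynomialPairing (MvPolynomial.monomial a.1 1)
  let T' : TestFunction (⊤ : Opens (EuclideanSpace ℝ (Fin d))) ℝ ⊤ →ₗ[ℝ] ℝ :=
    ⟨⟨T, map_add T⟩, map_smul T⟩
  have hker : ⨅ a, (M a).ker ≤ T'.ker := by
    intro φ hφ
    rw [Submodule.mem_iInf] at hφ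
    refine apply_eq_zero_of_forall_integral_eq_zero volume T φ fun ψ ↦ ?_
    -- After the swap, `φ` is integrated against a polynomial of degree at most `m`, all of whose
    -- monomials it annihilates.
    rw [integral_mul_translateDistribution_comm]
    obtain ⟨P, hP, hPψ⟩ := (isPolynomialMapOfDegreeLE_translateDistribution hS hT
      ψ).exists_mvPolynomial (continuous_translateDistribution_apply T ψ)
    simp only [hPψ]
    rw [← polynomialPairing_apply, ← P.support_sum_monomial_coeff, polynomialPairing_sum_monomial]
    refine Finset.sum_eq_zero fun a ha ↦ ?_
    have : polynomialPairing (MvPolynomial.monomial a 1) φ = 0 :=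
      hφ ⟨a, (MvPolynomial.le_totalDegree ha).trans hP⟩
    rw [this, mul_zero]
  -- `κ` is finite, so the kernel inclusion puts `T'` in the span of the `M a`.
  obtain ⟨c, hc⟩ := (Submodule.mem_span_range_iff_exists_fun ℝ).1
    (mem_span_of_iInf_ker_le_ker hker)
  refine ⟨∑ a : κ, MvPolynomial.monomial a.1 (c a), ?_, fun φ ↦ ?_⟩
  · refine (MvPolynomial.totalDegree_finsetSum _ _).trans (Finset.sup_le fun a _ ↦ ?_)
    exact (MvPolynomial.totalDegree_monomial_le _ _).trans a.2
  · have h1 := LinearMap.congr_fun hc φ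
    rw [LinearMap.sum_apply] at h1
    refine h1.symm.trans ((polynomialPairing_sum_monomial Finset.univ (fun a : κ ↦ a.1) c
      φ).symm.trans ?_)
    rw [polynomialPairing_apply]
    simp only [mul_comm]

theorem theorem1p1 (n : ℕ) (hn : 1 ≤ n) :
    (∀ (G H : Type*) [AddCommGroup G] [AddCommGroup H] (f : G → H) (E : Set G),
      AddSubgroup.closure E = ⊤ →
      (∀ h : Fin n → G, (∀ i, h i ∈ E) → mixedDiff h f = 0) →
      IsPolynomialMapOfDegreeLE f (n - 1)) ∧
    (∀ (G H : Type*) [AddCommGroup G] [TopologicalSpace G] [IsTopologicalAddGroup G]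
      [AddCommGroup H] [TopologicalSpace H] [IsTopologicalAddGroup H] [T2Space H]
      (f : G → H) (E : Set G),
      Continuous f →
      Dense (AddSubgroup.closure E : Set G) →
      (∀ h : Fin n → G, (∀ i, h i ∈ E) → mixedDiff h f = 0) →
      IsPolynomialMapOfDegreeLE f (n - 1)) ∧
    (∀ (d : ℕ) (f : Distribution (⊤ : TopologicalSpace.Opens (EuclideanSpace ℝ (Fin d))) ℝ ⊤)
      (E : Set (EuclideanSpace ℝ (Fin d))),
      Dense (AddSubgroup.closure E : Set (EuclideanSpace ℝ (Fin d))) →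
      (∀ h : Fin n → EuclideanSpace ℝ (Fin d), (∀ i, h i ∈ E) → mixedDiffDistribution h f = 0) →
      IsOrdinaryPolynomialOfDegreeLE f (n - 1)) := by
  obtain ⟨m, rfl⟩ := Nat.exists_eq_add_of_le' hn
  exact ⟨fun _ _ _ _ _ _ hE hf ↦ isPolynomialMapOfDegreeLE_of_closure_eq_top hE hf,
    fun _ _ _ _ _ _ _ _ _ _ _ hc hE hf ↦ isPolynomialMapOfDegreeLE_of_dense_closure hc hE hf,
    fun _ _ _ hE hf ↦ isOrdinaryPolynomialOfDegreeLE_of_dense_closure hE hf⟩
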